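/- Let $\mathcal F$ be an algebraically closed field of characteristic zero with an automorphism $\sigma$ (an inversive difference field), and let $n\in\mathbb N$. Let $\mathcal F\{\mathbb Y^{\pm}\}$ be the ring of Laurent difference polynomials in $\mathbb Y=(y_1,\dots,y_n)$, i.e. of finite $\mathcal F$-linear combinations of the Laurent monomials $\mathbb Y^{\mathbf f}$, $\mathbf f\in\mathbb Z[x]^n$, with $\mathbb Y^{\mathbf f}\mathbb Y^{\mathbf g}=\mathbb Y^{\mathbf f+\mathbf g}$ and $\sigma(a\mathbb Y^{\mathbf f})=\sigma(a)\mathbb Y^{x\mathbf f}$. A $\sigma$-ideal is an ideal $\mathcal I$ with $\sigma(\mathcal I)\subseteq\mathcal I$; $[S]$ is the $\sigma$-ideal generated by $S$. It is *perfect* if for all $p$ and all nonzero $a=\sum_i a_ix^i\in\mathbb N[x]$, $\prod_i\sigma^i(p)^{a_i}\in\mathcal I$ implies $p\in\mathcal I$; the *perfect closure* $\{\mathcal I\}$ is the smallest perfect $\sigma$-ideal containing $\mathcal I$. A Laurent $\sigma$-ideal is *binomial* if it is generated as a $\sigma$-ideal by elements $a\mathbb Y^{\mathbf g}+b\mathbb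 Y^{\mathbf h}$ ($a,b\in\mathcal F$). The *support lattice* of a $\sigma$-ideal $\mathcal I$ is $\mathbb L(\mathcal I)=\{\mathbf f\in\mathbb Z[x]^n : \mathbb Y^{\mathbf f}-c\in\mathcal I\text{ for some }c\in\mathcal F^*\}$, a $\mathbb Z[x]$-lattice, i.e. a $\mathbb Z[x]$-submodule of $\mathbb Z[x]^n$. A *partial character* $\rho$ is a group homomorphism from a $\mathbb Z[x]$-lattice $L_\rho\subseteq\mathbb Z[x]^n$ to $\mathcal F^*$ with $\rho(x\mathbf f)=\sigma(\rho(\mathbf f))$, and $\mathcal I(\rho)=[\mathbb Y^{\mathbf f}-\rho(\mathbf f)\mid \mathbf f\in L_\rho]$. For $m\ge 2$ let $o_m\in\{0,\dots,m-1\}$ be the integer such that $\sigma(\zeta)=\zeta^{o_m}$ for every $m$-th root of unity $\zeta\in\mathcal F$. A $\mathbb Z[x]$-lattice $L\subseteq\mathbb Z[x]^n$ is *P-saturated* if it is $x$-saturated ($x\mathbf f\in L$ implies $\mathbf f\in L$) and, for all $m\ge 2$ and $\mathbf f\in\mathbb Z[x]^n$, $m\mathbf f\in L$ implies $(x-o_m)\mathbf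 f\in L$. The *P-saturation* of $L$ is the smallest P-saturated $\mathbb Z[x]$-lattice containing $L$. **Theorem.** For every partial character $\rho$, the perfect closure of the Laurent binomial $\sigma$-ideal $\mathcal I(\rho)$ is either $[1]$ or a binomial $\sigma$-ideal whose support lattice is the P-saturation of $L_\rho$. Likewise, for every Laurent binomial $\sigma$-ideal $\mathcal I$, the perfect closure of $\mathcal I$ is either $[1]$ or a binomial $\sigma$-ideal whose support lattice is the P-saturation of $\mathbb L(\mathcal I)$. -/

import Mathlib

open Polynomial

namespace LaurentDiff

/-! ### Difference ideals in a commutative ring `R` with an endomorphism `s` -/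

section DifferenceRing

/-- A difference ideal (`σ`-ideal): an ideal closed under the transforming operator. -/
def IsDiffIdeal {R : Type*} [CommRing R] (s : R →+* R) (I : Ideal R) : Prop :=
  ∀ p ∈ I, s p ∈ I

/-- For `a = ∑ aᵢ xⁱ ∈ ℕ[x]`, the difference power `p ^ a = ∏ (σⁱ p) ^ aᵢ`. -/
noncomputable def diffPow {R : Type*} [CommRing R] (s : R →+* R) (p : R) (a : ℕ[X]) : R :=
  ∏ i ∈ a.support, (s^[i] p) ^ a.coeff i

/-- A perfect difference ideal: `p ^ a ∈ I` with `a ∈ ℕ[x] \ {0}` implies `p ∈ I`. -/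
def IsPerfect {R : Type*} [CommRing R] (s : R →+* R) (I : Ideal R) : Prop :=
  IsDiffIdeal s I ∧ ∀ (p : R) (a : ℕ[X]), a ≠ 0 → diffPow s p a ∈ I → p ∈ I

/-- The difference ideal `[S]` generated by a set `S`. -/
def diffSpan {R : Type*} [CommRing R] (s : R →+* R) (S : Set R) : Ideal R :=
  sInf {J | IsDiffIdeal s J ∧ S ⊆ J}

/-- The perfect closure `{I}`: the smallest perfect difference ideal containing `I`. -/
def perfectClosure {R : Type*} [CommRing R] (s : R →+* R) (I : Ideal R) : Ideal R :=
  sInf {J | IsPerfect s J ∧ I ≤ J}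

theorem isLeast_diffSpan {R : Type*} [CommRing R] (s : R →+* R) (S : Set R) :
    IsLeast {J : Ideal R | IsDiffIdeal s J ∧ S ⊆ J} (diffSpan s S) := by
  refine ⟨⟨fun p hp => ?_, fun p hp => ?_⟩, fun J hJ => sInf_le hJ⟩
  · rw [diffSpan, Submodule.mem_sInf] at hp ⊢
    exact fun J hJ => hJ.1 p (hp J hJ)
  · exact (Submodule.mem_sInf (x := p)).2 fun J hJ => hJ.2 hp

theorem isLeast_perfectClosure {R : Type*} [CommRing R] (s : R →+* R) (I : Ideal R) :
    IsLeast {J : Ideal R | IsPerfect s J ∧ I ≤ J} (perfectClosure s I) := by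
  refine ⟨⟨⟨fun p hp => ?_, fun p a ha hp => ?_⟩, fun p hp => ?_⟩, fun J hJ => sInf_le hJ⟩
  · rw [perfectClosure, Submodule.mem_sInf] at hp ⊢
    exact fun J hJ => hJ.1.1 p (hp J hJ)
  · rw [perfectClosure, Submodule.mem_sInf] at hp ⊢
    exact fun J hJ => hJ.1.2 p a ha (hp J hJ)
  · exact (Submodule.mem_sInf (x := p)).2 fun J hJ => hJ.2 hp

theorem isDiffIdeal_diffSpan {R : Type*} [CommRing R] (s : R →+* R) (S : Set R) :
    IsDiffIdeal s (diffSpan s S) :=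
  (isLeast_diffSpan s S).1.1

theorem isDiffIdeal_perfectClosure {R : Type*} [CommRing R] (s : R →+* R) (I : Ideal R) :
    IsDiffIdeal s (perfectClosure s I) :=
  (isLeast_perfectClosure s I).1.1.1

end DifferenceRing

/-! ### Laurent difference polynomials -/

/-- The ring `F{Y^±}` of Laurent difference polynomials in `Y = (y₁, …, yₙ)`: the finite
`F`-linear combinations of the Laurent difference monomials `Y ^ f`, `f ∈ ℤ[x]ⁿ`, with
`Y ^ f * Y ^ g = Y ^ (f + g)`. -/
abbrev LaurentDiffPoly (F : Type*) [Field F] (n : ℕ) : Type _ :=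
  AddMonoidAlgebra F (Fin n → ℤ[X])

/-- The term `a Y ^ f`. -/
noncomputable def term {F : Type*} [Field F] {n : ℕ} (a : F) (f : Fin n → ℤ[X]) :
    LaurentDiffPoly F n :=
  AddMonoidAlgebra.single f a

/-- The transforming operator of `F{Y^±}`: `a Y ^ f ↦ σ(a) Y ^ (x f)`. -/
noncomputable def transform {F : Type*} [Field F] (σ : F →+* F) (n : ℕ) :
    LaurentDiffPoly F n →+* LaurentDiffPoly F n :=
  (AddMonoidAlgebra.mapDomainRingHom F
      (DistribSMul.toAddMonoidHom (Fin n → ℤ[X]) (X : ℤ[X]))).comp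
    (AddMonoidAlgebra.mapRingHom (Fin n → ℤ[X]) σ)

theorem transform_term {F : Type*} [Field F] (σ : F →+* F) (n : ℕ) (a : F)
    (f : Fin n → ℤ[X]) :
    transform σ n (term a f) = term (σ a) ((X : ℤ[X]) • f) := by
  simp [transform, term]

theorem term_mul_term {F : Type*} [Field F] {n : ℕ} (a b : F) (f g : Fin n → ℤ[X]) :
    term a f * term b g = term (a * b) (f + g) := by
  simp [term, AddMonoidAlgebra.single_mul_single]

/-- A Laurent difference ideal is binomial if it is generated, as a difference ideal, by
Laurent difference binomials, i.e. by elements with at most two terms. -/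
def IsBinomialDiffIdeal {F : Type*} [Field F] (σ : F →+* F) {n : ℕ}
    (I : Ideal (LaurentDiffPoly F n)) : Prop :=
  ∃ S : Set (LaurentDiffPoly F n),
    (∀ p ∈ S, ∃ (a b : F) (g h : Fin n → ℤ[X]), p = term a g + term b h) ∧
      I = diffSpan (transform σ n) S

theorem IsBinomialDiffIdeal.isDiffIdeal {F : Type*} [Field F] {σ : F →+* F} {n : ℕ}
    {I : Ideal (LaurentDiffPoly F n)} (hI : IsBinomialDiffIdeal σ I) :
    IsDiffIdeal (transform σ n) I := by
  obtain ⟨S, -, rfl⟩ := hI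
  exact isDiffIdeal_diffSpan _ S

theorem support_add {F : Type*} [Field F] {n : ℕ} (I : Ideal (LaurentDiffPoly F n))
    {f g : Fin n → ℤ[X]} (hf : ∃ c : F, c ≠ 0 ∧ term 1 f - term c 0 ∈ I)
    (hg : ∃ c : F, c ≠ 0 ∧ term 1 g - term c 0 ∈ I) :
    ∃ c : F, c ≠ 0 ∧ term 1 (f + g) - term c 0 ∈ I := by
  obtain ⟨c, hc, hf⟩ := hf
  obtain ⟨d, hd, hg⟩ := hg
  refine ⟨c * d, mul_ne_zero hc hd, ?_⟩
  have h : (term 1 (f + g) - term (c * d) 0 : LaurentDiffPoly F n)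
      = term 1 f * (term 1 g - term d 0) + term d 0 * (term 1 f - term c 0) := by
    simp only [mul_sub, term_mul_term, one_mul, mul_one, add_zero, zero_add, mul_comm d c]
    abel
  rw [h]
  exact I.add_mem (I.mul_mem_left _ hg) (I.mul_mem_left _ hf)

/-- The support lattice `{f ∈ ℤ[x]ⁿ | Y ^ f - c ∈ I for some c ∈ F*}` of a Laurent difference
ideal `I`. -/
noncomputable def supportLattice {F : Type*} [Field F] {σ : F →+* F} {n : ℕ}
    (I : Ideal (LaurentDiffPoly F n)) (hI : IsDiffIdeal (transform σ n) I) :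
    Submodule ℤ[X] (Fin n → ℤ[X]) where
  carrier := {f | ∃ c : F, c ≠ 0 ∧ term 1 f - term c 0 ∈ I}
  zero_mem' := ⟨1, one_ne_zero, by simp⟩
  add_mem' := fun hf hg => support_add I hf hg
  smul_mem' := by
    intro q f hf
    have hadd := @support_add F _ n I
    have hneg : ∀ f : Fin n → ℤ[X],
        (∃ c : F, c ≠ 0 ∧ (term 1 f - term c 0 : LaurentDiffPoly F n) ∈ I) →
        ∃ c : F, c ≠ 0 ∧ (term 1 (-f) - term c 0 : LaurentDiffPoly F n) ∈ I := by
      rintro f ⟨c, hc, hf⟩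
      refine ⟨c⁻¹, inv_ne_zero hc, ?_⟩
      have h : (term 1 (-f) - term c⁻¹ 0 : LaurentDiffPoly F n)
          = -(term c⁻¹ (-f) * (term 1 f - term c 0)) := by
        simp only [mul_sub, term_mul_term, mul_one, neg_add_cancel, add_zero,
          inv_mul_cancel₀ hc]
        abel
      rw [h]
      exact I.neg_mem (I.mul_mem_left _ hf)
    have hX : ∀ f : Fin n → ℤ[X],
        (∃ c : F, c ≠ 0 ∧ (term 1 f - term c 0 : LaurentDiffPoly F n) ∈ I) →
        ∃ c : F, c ≠ 0 ∧ (term 1 ((X : ℤ[X]) • f) - term c 0 : LaurentDiffPoly F n) ∈ I := by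
      rintro f ⟨c, hc, hf⟩
      refine ⟨σ c, (map_ne_zero σ).2 hc, ?_⟩
      have h := hI _ hf
      rwa [map_sub, transform_term, transform_term, map_one, smul_zero] at h
    have hzero : ∃ c : F, c ≠ 0 ∧
        (term 1 (0 : Fin n → ℤ[X]) - term c 0 : LaurentDiffPoly F n) ∈ I :=
      ⟨1, one_ne_zero, by simp⟩
    have hint : ∀ (k : ℤ) (f : Fin n → ℤ[X]),
        (∃ c : F, c ≠ 0 ∧ (term 1 f - term c 0 : LaurentDiffPoly F n) ∈ I) →
        ∃ c : F, c ≠ 0 ∧ (term 1 (k • f) - term c 0 : LaurentDiffPoly F n) ∈ I := by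
      intro k f hf
      induction k using Int.induction_on with
      | zero => simpa using hzero
      | succ k ih =>
        rw [add_smul, one_smul]
        exact hadd ih hf
      | pred k ih =>
        rw [sub_smul, one_smul, sub_eq_add_neg]
        exact hadd ih (hneg _ hf)
    have hpow : ∀ (i : ℕ),
        ∃ c : F, c ≠ 0 ∧
          (term 1 ((X ^ i : ℤ[X]) • f) - term c 0 : LaurentDiffPoly F n) ∈ I := by
      intro i
      induction i with
      | zero => simpa using hf
      | succ i ih =>
        rw [pow_succ', mul_smul]
        exact hX _ ih
    change ∃ c : F, c ≠ 0 ∧ (term 1 (q • f) - term c 0 : LaurentDiffPoly F n) ∈ I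
    induction q using Polynomial.induction_on' with
    | add p q hp hq =>
      rw [add_smul]
      exact hadd hp hq
    | monomial i k =>
      have h : (monomial i k : ℤ[X]) • f = k • ((X ^ i : ℤ[X]) • f) := by
        rw [← smul_assoc, Polynomial.smul_X_eq_monomial]
      rw [h]
      exact hint k _ (hpow i)

/-! ### Partial characters -/

/-- A partial character on `ℤ[x]ⁿ`: a homomorphism `ρ` from a `ℤ[x]`-lattice `L_ρ ⊆ ℤ[x]ⁿ` to
`F*` such that `ρ(x f) = σ(ρ(f))`. -/
structure PartialCharacter {F : Type*} [Field F] (σ : F →+* F) (n : ℕ) where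
  /-- the lattice `L_ρ` -/
  lattice : Submodule ℤ[X] (Fin n → ℤ[X])
  /-- the values of the character -/
  toFun : lattice → Fˣ
  map_add : ∀ f g : lattice, toFun (f + g) = toFun f * toFun g
  map_X_smul : ∀ f : lattice, (toFun ((X : ℤ[X]) • f) : F) = σ (toFun f)

/-- The Laurent binomial difference ideal `I(ρ) = [Y ^ f - ρ(f) | f ∈ L_ρ]`. -/
noncomputable def PartialCharacter.ideal {F : Type*} [Field F] {σ : F →+* F} {n : ℕ}
    (ρ : PartialCharacter σ n) : Ideal (LaurentDiffPoly F n) :=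
  diffSpan (transform σ n)
    (Set.range fun f : ρ.lattice => term 1 (f : Fin n → ℤ[X]) - term (ρ.toFun f : F) 0)

/-! ### P-saturation -/

/-- The `m`-th transforming degree of unity `o_m`: the least natural number `o` such that
`σ(ζ) = ζ ^ o` for every `m`-th root of unity `ζ` of `F`. -/
noncomputable def transformingDegree {F : Type*} [Field F] (σ : F →+* F) (m : ℕ) : ℕ :=
  sInf {o : ℕ | ∀ ζ : F, ζ ^ m = 1 → σ ζ = ζ ^ o}

/-- A lattice `L ⊆ ℤ[x]ⁿ` is P-saturated if it is `x`-saturated and, for every integer `m ≥ 2`,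
`m f ∈ L` implies `(x - o_m) f ∈ L`. -/
def IsPSaturated {F : Type*} [Field F] (σ : F →+* F) {n : ℕ}
    (L : Submodule ℤ[X] (Fin n → ℤ[X])) : Prop :=
  (∀ f : Fin n → ℤ[X], (X : ℤ[X]) • f ∈ L → f ∈ L) ∧
    ∀ m : ℕ, 2 ≤ m → ∀ f : Fin n → ℤ[X], m • f ∈ L →
      ((X : ℤ[X]) - (transformingDegree σ m : ℤ[X])) • f ∈ L

/-- The P-saturation of `L`: the smallest P-saturated lattice containing `L`. -/
noncomputable def pSaturation {F : Type*} [Field F] (σ : F →+* F) {n : ℕ}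
    (L : Submodule ℤ[X] (Fin n → ℤ[X])) : Submodule ℤ[X] (Fin n → ℤ[X]) :=
  sInf {M | IsPSaturated σ M ∧ L ≤ M}

theorem isLeast_pSaturation {F : Type*} [Field F] (σ : F →+* F) {n : ℕ}
    (L : Submodule ℤ[X] (Fin n → ℤ[X])) :
    IsLeast {M | IsPSaturated σ M ∧ L ≤ M} (pSaturation σ L) := by
  refine ⟨⟨⟨fun f hf => ?_, fun m hm f hf => ?_⟩, fun f hf => ?_⟩, fun M hM => sInf_le hM⟩
  · rw [pSaturation, Submodule.mem_sInf] at hf ⊢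
    exact fun M hM => hM.1.1 f (hf M hM)
  · rw [pSaturation, Submodule.mem_sInf] at hf ⊢
    exact fun M hM => hM.1.2 m hm f (hf M hM)
  · exact (Submodule.mem_sInf (x := f)).2 fun M hM => hM.2 hf

/-- In an algebraically closed field of characteristic zero `o_m` has the expected properties. -/
theorem transformingDegree_spec {F : Type*} [Field F] [IsAlgClosed F] [CharZero F]
    (σ : F →+* F) (m : ℕ) (hm : 2 ≤ m) :
    transformingDegree σ m < m ∧ (transformingDegree σ m).Coprime m ∧
      ∀ ζ : F, ζ ^ m = 1 → σ ζ = ζ ^ transformingDegree σ m := by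
  have : NeZero m := ⟨by omega⟩
  have : NeZero (m : F) := ⟨by exact_mod_cast (by omega : m ≠ 0)⟩
  obtain ⟨z, hz⟩ := HasEnoughRootsOfUnity.exists_primitiveRoot F m
  have hσ : (σ z) ^ m = 1 := by rw [← map_pow, hz.pow_eq_one, map_one]
  obtain ⟨i, hi, hiz⟩ := hz.eq_pow_of_pow_eq_one hσ
  have hmem : i ∈ {o : ℕ | ∀ ζ : F, ζ ^ m = 1 → σ ζ = ζ ^ o} := by
    intro ζ hζ
    obtain ⟨j, -, rfl⟩ := hz.eq_pow_of_pow_eq_one hζ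
    rw [map_pow, ← hiz, ← pow_mul, ← pow_mul, mul_comm]
  have hspec : ∀ ζ : F, ζ ^ m = 1 → σ ζ = ζ ^ transformingDegree σ m := Nat.sInf_mem ⟨i, hmem⟩
  refine ⟨lt_of_le_of_lt (Nat.sInf_le hmem) hi, ?_, hspec⟩
  have hp : IsPrimitiveRoot (z ^ transformingDegree σ m) m := by
    rw [← hspec z hz.pow_eq_one]
    exact hz.map_of_injective σ.injective
  exact (hz.pow_iff_coprime (by omega) _).1 hp

end LaurentDiff

namespace LaurentDiff

/-! ### Characters of abelian groups with values in an algebraically closed field -/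

section Characters

variable {F : Type*} [Field F] {G : Type*} [AddCommGroup G]

/-! Characters `ψ` of the group `ℤ[x]ⁿ` with values in `Fˣ` serve as the points at which Laurent
difference polynomials are evaluated. Since `F` is algebraically closed, `Fˣ` is divisible, so
partial characters extend; by independence of characters, `I(ρ)` is exactly the vanishing ideal of
the extensions of `ρ` (`PartialCharacter.mem_ideal_iff`). In particular, the support lattice of
`I(ρ)` is no larger than `L_ρ`.

Let `J` be the perfect closure of `I(ρ)`, assumed proper, and let `P` be the P-saturation of `L_ρ`.
If `u ^ m - 1 ∈ J`, perfectness forces `σ(u) - u ^ o_m ∈ J` (`IsPerfect.map_sub_pow_mem`). With `u =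
c⁻¹ Y ^ f` this shows that the support lattice of `J` is P-saturated, hence contains `P`, and it
also gives the value of the character of `J` at `(x - o_m) f`.

Conversely, restrict the character of `J` to `P`. These known values make every extension commute
with the operators on the `ℤ`-saturation of `P`. The ideal of the restriction is then an
intersection of reflexive prime difference ideals, so it is perfect (`IsPerfect.isPerfect_ofIdeal`).
It contains `I(ρ)` and lies in `J`, so it equals `J`, and the support lattice of `J` is `P`. The
statement on binomial ideals follows because a proper one is `I(ρ)` for the character on its own
support lattice. -/

theorem baer_units [IsAlgClosed F] : Module.Baer ℤ (Additive Fˣ) := by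
  have hroot : ∀ {n : ℕ}, n ≠ 0 → Function.Surjective (fun a : Fˣ => a ^ n) := by
    intro n hn u
    obtain ⟨z, hz⟩ := IsAlgClosed.exists_pow_nat_eq (u : F) (Nat.pos_of_ne_zero hn)
    have hz0 : z ≠ 0 := by
      rintro rfl
      rw [zero_pow hn] at hz
      exact u.ne_zero hz.symm
    exact ⟨Units.mk0 z hz0, Units.ext (by simpa using hz)⟩
  let _ : RootableBy Fˣ ℕ := rootableByOfPowLeftSurj _ _ hroot
  let _ : RootableBy Fˣ ℤ := Group.rootableByIntOfRootableByNat Fˣ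
  let _ : DivisibleBy (Additive Fˣ) ℤ :=
    { div := fun a n => Additive.ofMul (RootableBy.root a.toMul n)
      div_zero := fun a => by
        rw [RootableBy.root_zero]; rfl
      div_cancel := fun {n} a hn => by
        rw [← ofMul_zpow, RootableBy.root_cancel _ hn]; rfl }
  exact Module.Baer.of_divisible _

/-- Characters of a subgroup extend to the whole group. -/
theorem exists_character_extension [IsAlgClosed F] {H : Type*} [AddCommGroup H] (i : H →+ G)
    (hi : Function.Injective i) (χ : H →+ Additive Fˣ) :
    ∃ ψ : G →+ Additive Fˣ, ∀ h, ψ (i h) = χ h := by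
  obtain ⟨ψ, hψ⟩ := baer_units.extension_property_addMonoidHom i hi χ
  exact ⟨ψ, fun h => DFunLike.congr_fun hψ h⟩

/-- Characters separate points. -/
theorem exists_character_ne_zero [IsAlgClosed F] [CharZero F] {g : G} (hg : g ≠ 0) :
    ∃ θ : G →+ Additive Fˣ, θ g ≠ 0 := by
  -- `u` is the intended value at `g`: any non-identity unit, here 2, if `g` has infinite order
  -- (`addOrderOf g = 0`), and otherwise a primitive root of unity of the order of `g`.
  obtain ⟨u, hu1, hu⟩ : ∃ u : Additive Fˣ, u ≠ 0 ∧ addOrderOf g • u = 0 := by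
    by_cases h0 : addOrderOf g = 0
    · refine ⟨Additive.ofMul (Units.mk0 2 two_ne_zero), fun h => ?_, by simp [h0]⟩
      have : (2 : F) = 1 := congrArg (fun v : Additive Fˣ => (v.toMul : F)) h
      norm_num at this
    · have : NeZero (addOrderOf g) := ⟨h0⟩
      have : NeZero (addOrderOf g : F) := ⟨by exact_mod_cast h0⟩
      obtain ⟨z, hz⟩ := HasEnoughRootsOfUnity.exists_primitiveRoot F (addOrderOf g)
      have hz1 : z ≠ 1 := fun h => by
        subst h
        exact hg (AddMonoid.addOrderOf_eq_one_iff.1 (IsPrimitiveRoot.one.unique hz).symm)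
      refine ⟨Additive.ofMul (hz.isUnit h0).unit, fun h => hz1 ?_, ?_⟩
      · simpa using congrArg (fun v : Additive Fˣ => (v.toMul : F)) h
      · rw [← ofMul_pow]
        exact congrArg Additive.ofMul (Units.ext (by simpa using hz.pow_eq_one))
  let e := AddSubgroup.zmultiples g
  let k : ℤ →+ e := (zmultiplesHom e) ⟨g, AddSubgroup.mem_zmultiples g⟩
  have hk : Function.Surjective k := by
    rintro ⟨x, m, rfl⟩
    exact ⟨m, Subtype.ext (by simp [k])⟩
  have hker : k.ker ≤ ((zmultiplesHom (Additive Fˣ)) u).ker := by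
    intro m hm
    have hm' : m • g = 0 := by
      have := congrArg Subtype.val (AddMonoidHom.mem_ker.1 hm)
      simpa [k] using this
    obtain ⟨q, rfl⟩ := addOrderOf_dvd_iff_zsmul_eq_zero.2 hm'
    rw [AddMonoidHom.mem_ker, zmultiplesHom_apply, mul_comm, mul_smul, natCast_zsmul, hu,
      smul_zero]
  obtain ⟨ψ, hψ⟩ := exists_character_extension (F := F) e.subtype Subtype.val_injective
    (k.liftOfSurjective hk ⟨_, hker⟩)
  refine ⟨ψ, fun h => hu1 ?_⟩
  have h1 := hψ (k 1)
  rw [AddMonoidHom.liftOfSurjective] at h1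
  rw [AddMonoidHom.liftOfRightInverse_comp_apply] at h1
  have h2 : e.subtype (k 1) = g := by simp [k]
  rw [h2, h] at h1
  simpa using h1.symm

/-- Evaluation of an element of the group algebra at a character. -/
noncomputable def charEval (θ : G →+ Additive Fˣ) : AddMonoidAlgebra F G →ₐ[F] F :=
  AddMonoidAlgebra.lift F F G ((Units.coeHom F).comp θ.toMultiplicativeLeft)

@[simp] theorem charEval_single (θ : G →+ Additive Fˣ) (g : G) (a : F) :
    charEval θ (AddMonoidAlgebra.single g a) = a * ((θ g).toMul : F) := by
  simp [charEval]

/-- An element of the group algebra that vanishes at every character is zero. -/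
theorem eq_zero_of_charEval [IsAlgClosed F] [CharZero F] {x : AddMonoidAlgebra F G}
    (hx : ∀ θ : G →+ Additive Fˣ, charEval θ x = 0) : x = 0 := by
  -- By biduality, elements of `G` become characters of the dual group; they are distinct because
  -- characters separate points, so Dedekind's independence theorem applies.
  let ev : G → (Multiplicative (G →+ Additive Fˣ) →* F) := fun g =>
    { toFun := fun θ => ((θ.toAdd g).toMul : F)
      map_one' := by simp
      map_mul' := by simp }
  have hev : Function.Injective ev := by
    intro g h hgh
    by_contra hne
    obtain ⟨θ, hθ⟩ := exists_character_ne_zero (F := F) (sub_ne_zero.2 hne)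
    refine hθ ?_
    rw [map_sub, sub_eq_zero]
    exact Units.ext (DFunLike.congr_fun hgh (Multiplicative.ofAdd θ))
  have hli := (linearIndependent_monoidHom (Multiplicative (G →+ Additive Fˣ)) F).comp ev hev
  rw [linearIndependent_iff] at hli
  rw [← AddMonoidAlgebra.coeff_eq_zero]
  refine hli x.coeff (funext fun θ => ?_)
  refine Eq.trans ?_ (hx θ.toAdd)
  rw [charEval, AddMonoidAlgebra.lift_apply, Finsupp.linearCombination_apply,
    Finsupp.sum, Finsupp.sum, Finset.sum_apply]
  rfl

end Characters

/-- The group algebra of a torsion-free abelian group has no zero divisors. -/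
theorem noZeroDivisors_of_isAddTorsionFree {F : Type*} [Field F] {G : Type*} [AddCommGroup G]
    [IsAddTorsionFree G] : NoZeroDivisors (AddMonoidAlgebra F G) := by
  have : TwoUniqueSums G :=
    -- A torsion-free group embeds in its divisible hull, a `ℚ`-vector space, where the unique sums
    -- property is available.
    TwoUniqueSums.of_injective_addHom (DivisibleHull.coeAddMonoidHom G : G →ₙ+ DivisibleHull G)
      DivisibleHull.coe_injective inferInstance
  infer_instance

/-! ### The ideal of a partial character -/

section CharacterIdeal

variable {F : Type*} [Field F] {σ : F →+* F} {n : ℕ}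

theorem laurent_induction {P : LaurentDiffPoly F n → Prop} (p : LaurentDiffPoly F n)
    (h0 : P 0) (hadd : ∀ p q, P p → P q → P (p + q)) (hterm : ∀ a f, P (term a f)) : P p :=
  AddMonoidAlgebra.induction_linear p h0 hadd fun f a => hterm a f

@[simp] theorem charEval_term (ψ : (Fin n → ℤ[X]) →+ Additive Fˣ) (a : F) (f : Fin n → ℤ[X]) :
    charEval ψ (term a f) = a * ((ψ f).toMul : F) :=
  charEval_single ψ f a

/-- A character of `ℤ[x]ⁿ` extends the partial character `ρ`. -/
def PartialCharacter.ExtendsTo (ρ : PartialCharacter σ n)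
    (ψ : (Fin n → ℤ[X]) →+ Additive Fˣ) : Prop :=
  ∀ f : ρ.lattice, (ψ f).toMul = ρ.toFun f

theorem PartialCharacter.exists_extendsTo [IsAlgClosed F] (ρ : PartialCharacter σ n) :
    ∃ ψ, ρ.ExtendsTo ψ := by
  obtain ⟨ψ, hψ⟩ := exists_character_extension (F := F) ρ.lattice.subtype.toAddMonoidHom
    Subtype.val_injective
    (AddMonoidHom.mk' (fun f => Additive.ofMul (ρ.toFun f)) fun f g => by
      rw [ρ.map_add, ofMul_mul])
  exact ⟨ψ, fun f => congrArg Additive.toMul (hψ f)⟩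

/-- The homomorphism `Y ^ f ↦ ψ(f) [f]` to the group algebra of `ℤ[x]ⁿ / L`. -/
noncomputable def twist (L : Submodule ℤ[X] (Fin n → ℤ[X]))
    (ψ : (Fin n → ℤ[X]) →+ Additive Fˣ) :
    LaurentDiffPoly F n →ₐ[F] AddMonoidAlgebra F ((Fin n → ℤ[X]) ⧸ L) :=
  AddMonoidAlgebra.lift F _ _
    { toFun := fun f => AddMonoidAlgebra.single (L.mkQ f.toAdd) ((ψ f.toAdd).toMul : F)
      map_one' := by simp [AddMonoidAlgebra.one_def]
      map_mul' := fun f g => by simp [AddMonoidAlgebra.single_mul_single] }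

@[simp] theorem twist_term (L : Submodule ℤ[X] (Fin n → ℤ[X]))
    (ψ : (Fin n → ℤ[X]) →+ Additive Fˣ) (a : F) (f : Fin n → ℤ[X]) :
    twist L ψ (term a f) = AddMonoidAlgebra.single (L.mkQ f) (a * ((ψ f).toMul : F)) := by
  simp [twist, term]

theorem PartialCharacter.generator_mem_ideal (ρ : PartialCharacter σ n) (f : ρ.lattice) :
    term 1 (f : Fin n → ℤ[X]) - term (ρ.toFun f : F) 0 ∈ ρ.ideal :=
  (isLeast_diffSpan _ _).1.2 ⟨f, rfl⟩

theorem PartialCharacter.mem_ideal_of_twist_eq_zero {ρ : PartialCharacter σ n}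
    {ψ : (Fin n → ℤ[X]) →+ Additive Fˣ} (hψ : ρ.ExtendsTo ψ) {p : LaurentDiffPoly F n}
    (hp : twist ρ.lattice ψ p = 0) : p ∈ ρ.ideal := by
  let r : (Fin n → ℤ[X]) ⧸ ρ.lattice → (Fin n → ℤ[X]) := Quotient.out
  have hr : ∀ f, f - r (ρ.lattice.mkQ f) ∈ ρ.lattice := fun f => by
    rw [← Submodule.Quotient.eq]
    exact (Quotient.out_eq (ρ.lattice.mkQ f)).symm
  -- `T` is an additive section of `twist`, sending `[C]` to `ψ(r C)⁻¹ Y ^ (r C)`. Modulo `I(ρ)`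
  -- every term is congruent to its image under `T ∘ twist`, because `Y ^ f - ψ(f - r) Y ^ r = Y ^ r
  -- (Y ^ (f - r) - ρ(f - r))` for `r` the chosen representative of `f`.
  let T : AddMonoidAlgebra F ((Fin n → ℤ[X]) ⧸ ρ.lattice) →+ LaurentDiffPoly F n :=
    (Finsupp.liftAddHom fun C =>
      (AddMonoidAlgebra.singleAddHom (r C)).comp
        (AddMonoidHom.mulRight (((ψ (r C)).toMul⁻¹ : Fˣ) : F))).comp
      AddMonoidAlgebra.coeffAddEquiv.toAddMonoidHom
  have hT : ∀ C a, T (AddMonoidAlgebra.single C a) =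
      term (a * (((ψ (r C)).toMul⁻¹ : Fˣ) : F)) (r C) := fun C a => by
    simp [T, term]
  have key : ∀ q : LaurentDiffPoly F n, q - T (twist ρ.lattice ψ q) ∈ ρ.ideal := by
    intro q
    induction q using laurent_induction with
    | h0 => simp
    | hadd p q hp hq =>
      rw [_root_.map_add, _root_.map_add, add_sub_add_comm]
      exact ρ.ideal.add_mem hp hq
    | hterm a f =>
      rw [twist_term, hT]
      have h1 := ρ.ideal.mul_mem_left (term a (r (ρ.lattice.mkQ f)))
        (ρ.generator_mem_ideal ⟨_, hr f⟩)
      rw [← hψ, mul_sub, term_mul_term, term_mul_term, mul_one, add_sub_cancel, add_zero,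
        map_sub, toMul_sub, div_eq_mul_inv, Units.val_mul, ← mul_assoc] at h1
      exact h1
  simpa [hp] using key p

/-- The translate of a character by the transforming operator. -/
noncomputable def shiftCharacter (hσ : Function.Bijective σ)
    (ψ : (Fin n → ℤ[X]) →+ Additive Fˣ) : (Fin n → ℤ[X]) →+ Additive Fˣ :=
  (Units.map ((RingEquiv.ofBijective σ hσ).symm : F →* F)).toAdditive.comp
    (ψ.comp (DistribSMul.toAddMonoidHom (Fin n → ℤ[X]) (X : ℤ[X])))

theorem map_shiftCharacter (hσ : Function.Bijective σ) (ψ : (Fin n → ℤ[X]) →+ Additive Fˣ)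
    (f : Fin n → ℤ[X]) :
    σ ((shiftCharacter hσ ψ f).toMul : F) = ((ψ ((X : ℤ[X]) • f)).toMul : F) :=
  (RingEquiv.ofBijective σ hσ).apply_symm_apply _

/-- On the lattice, multiplying by `x` and then undoing `σ` leaves the values unchanged. Stability
of the set of extensions under the shift is what makes their vanishing ideal a difference ideal. -/
theorem PartialCharacter.ExtendsTo.shift (hσ : Function.Bijective σ) {ρ : PartialCharacter σ n}
    {ψ : (Fin n → ℤ[X]) →+ Additive Fˣ} (hψ : ρ.ExtendsTo ψ) :
    ρ.ExtendsTo (shiftCharacter hσ ψ) := fun f => by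
  refine Units.ext (σ.injective ?_)
  rw [map_shiftCharacter, ← ρ.map_X_smul, ← hψ]
  rfl

theorem charEval_transform (hσ : Function.Bijective σ) (ψ : (Fin n → ℤ[X]) →+ Additive Fˣ)
    (p : LaurentDiffPoly F n) :
    charEval ψ (transform σ n p) = σ (charEval (shiftCharacter hσ ψ) p) := by
  induction p using laurent_induction with
  | h0 => simp
  | hadd p q hp hq => simp only [map_add, hp, hq]
  | hterm a f => rw [transform_term, charEval_term, charEval_term, map_mul, map_shiftCharacter]

/-- The character changes because `ψ` need not commute with the operators outside the lattice. -/
theorem twist_transform (hσ : Function.Bijective σ) (L : Submodule ℤ[X] (Fin n → ℤ[X]))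
    (ψ : (Fin n → ℤ[X]) →+ Additive Fˣ) (p : LaurentDiffPoly F n) :
    twist L ψ (transform σ n p) = AddMonoidAlgebra.mapDomain (fun C => (X : ℤ[X]) • C)
      (AddMonoidAlgebra.map (σ : F →+ F) (twist L (shiftCharacter hσ ψ) p)) := by
  induction p using laurent_induction with
  | h0 => simp
  | hadd p q hp hq => simp only [map_add, hp, hq, AddMonoidAlgebra.map_add,
      AddMonoidAlgebra.mapDomain_add]
  | hterm a f =>
    rw [transform_term, twist_term, twist_term, AddMonoidAlgebra.map_single,
      AddMonoidAlgebra.mapDomain_single, ← map_shiftCharacter hσ]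
    simp

/-! ### A Nullstellensatz for ideals of partial characters. -/

variable [IsAlgClosed F] [CharZero F]

/-- Evaluating `twist` at a character `θ` of the quotient is evaluating at `ψ + θ ∘ mkQ`, which
again extends `ρ`. So the twisted element vanishes at every `θ`. -/
theorem PartialCharacter.twist_eq_zero {ρ : PartialCharacter σ n}
    {ψ : (Fin n → ℤ[X]) →+ Additive Fˣ} (hψ : ρ.ExtendsTo ψ) {p : LaurentDiffPoly F n}
    (hp : ∀ ψ, ρ.ExtendsTo ψ → charEval ψ p = 0) : twist ρ.lattice ψ p = 0 := by
  refine eq_zero_of_charEval fun θ => ?_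
  have hθ : ∀ q : LaurentDiffPoly F n, charEval θ (twist ρ.lattice ψ q) =
      charEval (ψ + θ.comp ρ.lattice.mkQ.toAddMonoidHom) q := by
    intro q
    induction q using laurent_induction with
    | h0 => simp
    | hadd p q hp hq => simp only [_root_.map_add, hp, hq]
    | hterm a f => simp [mul_assoc]
  rw [hθ]
  refine hp _ fun f => ?_
  have hf : (Submodule.Quotient.mk (f : Fin n → ℤ[X]) : (Fin n → ℤ[X]) ⧸ ρ.lattice) = 0 :=
    (Submodule.Quotient.mk_eq_zero _).2 f.2
  simp [← hψ f, hf]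

/-- `I(ρ)` is the ideal of the set of characters extending `ρ`. -/
theorem PartialCharacter.mem_ideal_iff (hσ : Function.Bijective σ) {ρ : PartialCharacter σ n}
    {p : LaurentDiffPoly F n} :
    p ∈ ρ.ideal ↔ ∀ ψ, ρ.ExtendsTo ψ → charEval ψ p = 0 := by
  refine ⟨fun hp => ?_, fun hp => ?_⟩
  · let Z : Ideal (LaurentDiffPoly F n) :=
      ⨅ ψ : {ψ // ρ.ExtendsTo ψ}, RingHom.ker (charEval ψ.1)
    have hZ : ∀ q, q ∈ Z ↔ ∀ ψ, ρ.ExtendsTo ψ → charEval ψ q = 0 := fun q => by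
      simp [Z, Submodule.mem_iInf, RingHom.mem_ker]
    refine (hZ p).1 ((isLeast_diffSpan _ _).2 ⟨fun q hq => ?_, ?_⟩ hp)
    · rw [hZ] at hq ⊢
      intro ψ hψ
      rw [charEval_transform hσ, hq _ (hψ.shift hσ), map_zero]
    · rintro _ ⟨f, rfl⟩
      refine (hZ _).2 fun ψ hψ => ?_
      simp [← hψ f]
  · obtain ⟨ψ, hψ⟩ := ρ.exists_extendsTo
    exact mem_ideal_of_twist_eq_zero hψ (twist_eq_zero hψ hp)

theorem PartialCharacter.mem_ideal_iff_twist (hσ : Function.Bijective σ)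
    {ρ : PartialCharacter σ n} {ψ : (Fin n → ℤ[X]) →+ Additive Fˣ} (hψ : ρ.ExtendsTo ψ)
    {p : LaurentDiffPoly F n} : p ∈ ρ.ideal ↔ twist ρ.lattice ψ p = 0 :=
  ⟨fun hp => twist_eq_zero hψ ((mem_ideal_iff hσ).1 hp), mem_ideal_of_twist_eq_zero hψ⟩

theorem PartialCharacter.mem_lattice_of_mem_ideal (hσ : Function.Bijective σ)
    {ρ : PartialCharacter σ n} {f : Fin n → ℤ[X]} {c : F}
    (h : term 1 f - term c 0 ∈ ρ.ideal) : f ∈ ρ.lattice := by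
  obtain ⟨ψ, hψ⟩ := ρ.exists_extendsTo
  rw [mem_ideal_iff_twist hσ hψ, map_sub, twist_term, twist_term, sub_eq_zero,
    AddMonoidAlgebra.single_inj] at h
  rcases h with ⟨h, -⟩ | ⟨h, -⟩
  · rwa [map_zero, Submodule.mkQ_apply, Submodule.Quotient.mk_eq_zero] at h
  · simp at h

/-! ### Perfect ideals of partial characters -/

theorem isPerfect_of_isPrime {R : Type*} [CommRing R] {s : R →+* R} {I : Ideal R}
    (hI : IsDiffIdeal s I) (hp : I.IsPrime) (hr : ∀ p, s p ∈ I → p ∈ I) : IsPerfect s I := by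
  refine ⟨hI, fun p a _ hpa => ?_⟩
  obtain ⟨i, -, hi⟩ := (hp.prod_mem_iff).1 hpa
  have hi' := hp.mem_of_pow_mem _ hi
  clear hi
  induction i with
  | zero => exact hi'
  | succ i ih =>
    rw [Function.iterate_succ_apply'] at hi'
    exact ih (hr _ hi')

/-- The quotient by the lattice is torsion-free, so its group algebra is a domain and the ideal, the
kernel of `twist`, is prime. Injectivity of `x` on the quotient makes it reflexive. -/
theorem PartialCharacter.isPerfect_ideal_of_saturated (hσ : Function.Bijective σ)
    (ρ : PartialCharacter σ n)
    (hX : ∀ f : Fin n → ℤ[X], (X : ℤ[X]) • f ∈ ρ.lattice → f ∈ ρ.lattice)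
    (hZ : ∀ m : ℕ, m ≠ 0 → ∀ f : Fin n → ℤ[X], m • f ∈ ρ.lattice → f ∈ ρ.lattice) :
    IsPerfect (transform σ n) ρ.ideal := by
  obtain ⟨ψ, hψ⟩ := ρ.exists_extendsTo
  have hinj : ∀ {C : (Fin n → ℤ[X]) ⧸ ρ.lattice}, (X : ℤ[X]) • C = 0 → C = 0 := by
    intro C hC
    obtain ⟨f, rfl⟩ := ρ.lattice.mkQ_surjective C
    rw [← map_smul, Submodule.mkQ_apply, Submodule.Quotient.mk_eq_zero] at hC
    exact (Submodule.Quotient.mk_eq_zero _).2 (hX f hC)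
  have htf : IsAddTorsionFree ((Fin n → ℤ[X]) ⧸ ρ.lattice) := by
    refine ⟨fun m hm => (injective_iff_map_eq_zero
      (nsmulAddMonoidHom m : (Fin n → ℤ[X]) ⧸ ρ.lattice →+ _)).2 fun C hC => ?_⟩
    obtain ⟨f, rfl⟩ := ρ.lattice.mkQ_surjective C
    rw [nsmulAddMonoidHom_apply, ← map_nsmul, Submodule.mkQ_apply,
      Submodule.Quotient.mk_eq_zero] at hC
    exact (Submodule.Quotient.mk_eq_zero _).2 (hZ m hm f hC)
  have := noZeroDivisors_of_isAddTorsionFree (F := F) (G := (Fin n → ℤ[X]) ⧸ ρ.lattice)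
  have : IsDomain (AddMonoidAlgebra F ((Fin n → ℤ[X]) ⧸ ρ.lattice)) := NoZeroDivisors.to_isDomain _
  have hker : ρ.ideal = RingHom.ker (twist ρ.lattice ψ) :=
    Ideal.ext fun p => mem_ideal_iff_twist hσ hψ
  refine isPerfect_of_isPrime (isDiffIdeal_diffSpan _ _) ?_ fun p hp => ?_
  · rw [hker]
    exact RingHom.ker_isPrime _
  -- Membership may be tested with any extension; the shifted one is the one that `twist_transform`
  -- produces.
  · rw [mem_ideal_iff_twist hσ (hψ.shift hσ)]
    rw [mem_ideal_iff_twist hσ hψ, twist_transform hσ] at hp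
    have hXinj : Function.Injective
        fun C : (Fin n → ℤ[X]) ⧸ ρ.lattice => (X : ℤ[X]) • C := fun C D hCD =>
      sub_eq_zero.1 (hinj (by rw [smul_sub]; exact sub_eq_zero.2 hCD))
    have hσinj : Function.Injective (σ : F →+ F) := σ.injective
    refine AddMonoidAlgebra.map_injective _ hσinj
      (AddMonoidAlgebra.mapDomain_injective hXinj ?_)
    rw [hp, AddMonoidAlgebra.map_zero, AddMonoidAlgebra.mapDomain_zero]

end CharacterIdeal

/-! ### Perfect difference ideals -/

section Perfect

variable {R : Type*} [CommRing R] {s : R →+* R} {J : Ideal R}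

theorem diffPow_eq_prod_range (s : R →+* R) (p : R) {a : ℕ[X]} {N : ℕ} (hN : a.natDegree < N) :
    diffPow s p a = ∏ i ∈ Finset.range N, (s^[i] p) ^ a.coeff i :=
  Finset.prod_subset (fun i hi => Finset.mem_range.2
    ((le_natDegree_of_mem_supp i hi).trans_lt hN)) fun i _ hi => by
      rw [notMem_support_iff.1 hi, pow_zero]

theorem IsPerfect.mem_of_pow_mem (hJ : IsPerfect s J) {p : R} {k : ℕ} (hk : k ≠ 0)
    (h : p ^ k ∈ J) : p ∈ J := by
  refine hJ.2 p (C k) (C_ne_zero.2 hk) ?_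
  rw [diffPow_eq_prod_range s p (N := 1) (by rw [natDegree_C]; exact one_pos)]
  simpa using h

theorem IsPerfect.mem_of_map_mem (hJ : IsPerfect s J) {p : R} (h : s p ∈ J) : p ∈ J := by
  refine hJ.2 p X X_ne_zero ?_
  rw [diffPow_eq_prod_range s p (N := 2) (by rw [natDegree_X]; exact one_lt_two)]
  simpa [Finset.prod_range_succ] using h

/-- The difference power of `σ(a) b` with exponent `x + 1` is a multiple of `σ(a b)`. -/
theorem IsPerfect.map_mul_mem (hJ : IsPerfect s J) {a b : R} (h : a * b ∈ J) : s a * b ∈ J := by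
  have hdeg : (X + C 1 : ℕ[X]).natDegree = 1 := natDegree_X_add_C 1
  refine hJ.2 _ (X + C 1) (ne_zero_of_natDegree_gt (n := 0) (by omega)) ?_
  rw [diffPow_eq_prod_range s _ (N := 2) (by omega)]
  have h1 : s (a * b) * (s (s a) * b) ∈ J := J.mul_mem_right _ (hJ.1 _ h)
  have h2 : s a * b * (s (s a) * s b) = s (a * b) * (s (s a) * b) := by
    rw [map_mul]; ring
  simpa [Finset.prod_range_succ, coeff_X, coeff_one, h2] using h1

/-- Factors are replaced one at a time by `IsPerfect.map_mul_mem`; the free cofactor `b` absorbs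
those already replaced. -/
theorem IsPerfect.prod_map_sub_mul_mem (hJ : IsPerfect s J) {ι : Type*} (A : Finset ι)
    (q h : ι → R) : ∀ b : R, (∏ i ∈ A, q i) * b ∈ J →
      (∏ i ∈ A, (s (q i) - h i * q i)) * b ∈ J := by
  classical
  induction A using Finset.induction_on with
  | empty => exact fun b hb => by simpa using hb
  | insert i A hi ih =>
    intro b hb
    rw [Finset.prod_insert hi, mul_assoc] at hb
    have h1 : (∏ j ∈ A, q j) * ((s (q i) - h i * q i) * b) ∈ J := by
      have := J.sub_mem (hJ.map_mul_mem hb) (J.mul_mem_left (h i) hb)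
      convert this using 1
      ring
    rw [Finset.prod_insert hi]
    convert ih _ h1 using 1
    ring

theorem isPerfect_iInf {ι : Sort*} {J : ι → Ideal R} (hJ : ∀ i, IsPerfect s (J i)) :
    IsPerfect s (⨅ i, J i) := by
  refine ⟨fun p hp => ?_, fun p a ha hp => ?_⟩ <;> rw [Submodule.mem_iInf] at hp ⊢
  · exact fun i => (hJ i).1 p (hp i)
  · exact fun i => (hJ i).2 p a ha (hp i)

/-- The transforming operator acts on roots of unity modulo a perfect difference ideal by
`u ↦ u ^ o_m`. -/
theorem IsPerfect.map_sub_pow_mem {F : Type*} [Field F] [IsAlgClosed F] [CharZero F]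
    {σ : F →+* F} [Algebra F R] (hs : ∀ a, s (algebraMap F R a) = algebraMap F R (σ a))
    (hJ : IsPerfect s J) {m : ℕ} (hm : 2 ≤ m) {u : R} (hu : u ^ m - 1 ∈ J) :
    s u - u ^ transformingDegree σ m ∈ J := by
  obtain ⟨-, -, ho⟩ := transformingDegree_spec σ m hm
  set o := transformingDegree σ m
  have : NeZero m := ⟨by omega⟩
  have : NeZero (m : F) := ⟨by exact_mod_cast (by omega : m ≠ 0)⟩
  obtain ⟨z, hz⟩ := HasEnoughRootsOfUnity.exists_primitiveRoot F m
  let A := nthRootsFinset m (1 : F)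
  have hprod : ∏ ζ ∈ A, (u - algebraMap F R ζ) = u ^ m - 1 := by
    have := congrArg (aeval u) (X_pow_sub_one_eq_prod (by omega) hz)
    simpa [map_prod] using this.symm
  -- With `h ζ = (u ^ o - ζ ^ o) / (u - ζ)`, the replacement of every factor `u - ζ` is the same
  -- element `σ(u) - u ^ o`, so its `m`-th power lies in `J`.
  have hdvd : ∀ ζ : F, ∃ h : R,
      u ^ o - algebraMap F R ζ ^ o = h * (u - algebraMap F R ζ) := fun ζ => by
    obtain ⟨h, hh⟩ := sub_dvd_pow_sub_pow u (algebraMap F R ζ) o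
    exact ⟨h, by rw [hh, mul_comm]⟩
  choose h hh using hdvd
  have key := hJ.prod_map_sub_mul_mem A (fun ζ => u - algebraMap F R ζ) h 1
    (by rw [hprod, mul_one]; exact hu)
  have hconst : ∀ ζ ∈ A, s (u - algebraMap F R ζ) - h ζ * (u - algebraMap F R ζ) =
      s u - u ^ o := by
    intro ζ hζ
    rw [← hh, map_sub, hs, ho ζ ((mem_nthRootsFinset (by omega) _).1 hζ), map_pow]
    ring
  rw [Finset.prod_congr rfl hconst, Finset.prod_const, mul_one, hz.card_nthRootsFinset] at key
  exact hJ.mem_of_pow_mem (by omega) key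

end Perfect

/-! ### Partial characters of difference ideals -/

section Support

variable {F : Type*} [Field F] {σ : F →+* F} {n : ℕ} {J : Ideal (LaurentDiffPoly F n)}

theorem eq_top_of_term_mem {a : F} (ha : a ≠ 0) {f : Fin n → ℤ[X]} (h : term a f ∈ J) :
    J = ⊤ := by
  rw [Ideal.eq_top_iff_one]
  have h1 := J.mul_mem_left (term a⁻¹ (-f)) h
  rwa [term_mul_term, inv_mul_cancel₀ ha, neg_add_cancel] at h1

theorem support_value_unique (hJ : J ≠ ⊤) {f : Fin n → ℤ[X]} {c d : F}
    (hc : term 1 f - term c 0 ∈ J) (hd : term 1 f - term d 0 ∈ J) : c = d := by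
  by_contra hcd
  refine hJ (eq_top_of_term_mem (a := c - d) (f := 0) (sub_ne_zero.2 hcd) ?_)
  convert J.sub_mem hd hc using 1
  simp [term, AddMonoidAlgebra.single_sub]

theorem term_add_sub_mem {f g : Fin n → ℤ[X]} {c d : F}
    (hc : term 1 f - term c 0 ∈ J) (hd : term 1 g - term d 0 ∈ J) :
    term 1 (f + g) - term (c * d) 0 ∈ J := by
  have h : (term 1 (f + g) - term (c * d) 0 : LaurentDiffPoly F n)
      = term 1 f * (term 1 g - term d 0) + term d 0 * (term 1 f - term c 0) := by
    simp only [mul_sub, term_mul_term, one_mul, mul_one, add_zero, zero_add, mul_comm d c]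
    abel
  rw [h]
  exact J.add_mem (J.mul_mem_left _ hd) (J.mul_mem_left _ hc)

/-- The partial character `f ↦ c`, where `Y ^ f - c ∈ J`, on a sublattice of the support
lattice of a proper difference ideal `J`. -/
noncomputable def PartialCharacter.ofIdeal (hJ : IsDiffIdeal (transform σ n) J) (hJ1 : J ≠ ⊤)
    (P : Submodule ℤ[X] (Fin n → ℤ[X])) (hP : P ≤ supportLattice J hJ) :
    PartialCharacter σ n where
  lattice := P
  toFun f := Units.mk0 _ (hP f.2).choose_spec.1
  map_add f g := Units.ext <| support_value_unique hJ1 (hP (f + g).2).choose_spec.2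
    (term_add_sub_mem (hP f.2).choose_spec.2 (hP g.2).choose_spec.2)
  map_X_smul f := support_value_unique hJ1 (hP ((X : ℤ[X]) • f).2).choose_spec.2 <| by
    have h := hJ _ (hP f.2).choose_spec.2
    rwa [map_sub, transform_term, transform_term, map_one, smul_zero] at h

section OfIdeal

variable (hJ : IsDiffIdeal (transform σ n) J) (hJ1 : J ≠ ⊤)
  {P : Submodule ℤ[X] (Fin n → ℤ[X])} (hP : P ≤ supportLattice J hJ)

theorem PartialCharacter.ofIdeal_spec (f : P) :
    term 1 (f : Fin n → ℤ[X]) - term ((ofIdeal hJ hJ1 P hP).toFun f : F) 0 ∈ J :=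
  (hP f.2).choose_spec.2

theorem PartialCharacter.ofIdeal_ideal_le : (ofIdeal hJ hJ1 P hP).ideal ≤ J := by
  refine (isLeast_diffSpan _ _).2 ⟨hJ, ?_⟩
  rintro _ ⟨f, rfl⟩
  exact ofIdeal_spec hJ hJ1 hP f

theorem PartialCharacter.mem_ofIdeal_ideal {f : Fin n → ℤ[X]} {c : F} (hf : f ∈ P)
    (h : term 1 f - term c 0 ∈ J) : term 1 f - term c 0 ∈ (ofIdeal hJ hJ1 P hP).ideal := by
  rw [support_value_unique hJ1 h (ofIdeal_spec hJ hJ1 hP ⟨f, hf⟩)]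
  exact generator_mem_ideal (ofIdeal hJ hJ1 P hP) ⟨f, hf⟩

theorem PartialCharacter.ExtendsTo.term_sub_mem {ψ : (Fin n → ℤ[X]) →+ Additive Fˣ}
    (hψ : (PartialCharacter.ofIdeal hJ hJ1 P hP).ExtendsTo ψ) {f : Fin n → ℤ[X]} (hf : f ∈ P) :
    term 1 f - term ((ψ f).toMul : F) 0 ∈ J := by
  rw [show (ψ f).toMul = (ofIdeal hJ hJ1 P hP).toFun (⟨f, hf⟩ : P) from hψ ⟨f, hf⟩]
  exact ofIdeal_spec hJ hJ1 hP ⟨f, hf⟩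

end OfIdeal

theorem PartialCharacter.isBinomialDiffIdeal_ideal (ρ : PartialCharacter σ n) :
    IsBinomialDiffIdeal σ ρ.ideal := by
  refine ⟨_, ?_, rfl⟩
  rintro _ ⟨f, rfl⟩
  refine ⟨1, -(ρ.toFun f : F), f, 0, ?_⟩
  simp [term, AddMonoidAlgebra.single_neg, sub_eq_add_neg]

/-- A proper binomial difference ideal is the ideal of a partial character. -/
theorem IsBinomialDiffIdeal.eq_ideal (hJ : IsBinomialDiffIdeal σ J) (hJ1 : J ≠ ⊤) :
    J = (PartialCharacter.ofIdeal hJ.isDiffIdeal hJ1 _ le_rfl).ideal := by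
  refine le_antisymm ?_ (PartialCharacter.ofIdeal_ideal_le _ _ _)
  obtain ⟨S, hS, hJS⟩ := id hJ
  conv_lhs => rw [hJS]
  refine (isLeast_diffSpan _ _).2 ⟨isDiffIdeal_diffSpan _ _, fun p hp => ?_⟩
  have hpJ : p ∈ J := hJS ▸ (isLeast_diffSpan _ _).1.2 hp
  obtain ⟨a, b, g, h, rfl⟩ := hS p hp
  have hz : ∀ f, (term 0 f : LaurentDiffPoly F n) = 0 := fun f => by simp [term]
  by_cases ha : a = 0
  · subst ha
    by_cases hb : b = 0
    · subst hb
      simp [hz]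
    · exact absurd (eq_top_of_term_mem hb (by simpa [hz] using hpJ)) hJ1
  by_cases hb : b = 0
  · subst hb
    exact absurd (eq_top_of_term_mem ha (by simpa [hz] using hpJ)) hJ1
  -- Up to a unit, a binomial with two nonzero coefficients is `Y ^ f - c`.
  have hbin : (term a g + term b h : LaurentDiffPoly F n) =
      term a h * (term 1 (g - h) - term (-b / a) 0) := by
    rw [mul_sub, term_mul_term, term_mul_term, mul_one, add_sub_cancel, add_zero,
      mul_div_cancel₀ _ ha]
    simp [term, AddMonoidAlgebra.single_neg]
  have hmem : (term 1 (g - h) - term (-b / a) 0 : LaurentDiffPoly F n) ∈ J := by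
    have h1 := J.mul_mem_left (term a⁻¹ (-h)) hpJ
    rwa [hbin, ← mul_assoc, term_mul_term, inv_mul_cancel₀ ha, neg_add_cancel,
      show (term 1 0 : LaurentDiffPoly F n) = 1 from rfl, one_mul] at h1
  rw [hbin]
  exact Ideal.mul_mem_left _ _ (PartialCharacter.mem_ofIdeal_ideal _ _ _
    ⟨_, div_ne_zero (neg_ne_zero.2 hb) ha, hmem⟩ hmem)

/-! ### Perfect ideals and P-saturated lattices. -/

variable [IsAlgClosed F] [CharZero F]

/-- This is `IsPerfect.map_sub_pow_mem` for `u = c⁻¹ Y ^ f`. Since `c` may be any `m`-th root of the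
value at `m • f`, it can later be taken to be `ψ(f)` for an arbitrary extension `ψ`. -/
theorem IsPerfect.term_sub_mem (hJ : IsPerfect (transform σ n) J) {m : ℕ} (hm : 2 ≤ m)
    {f : Fin n → ℤ[X]} {c : F} (hc : c ≠ 0) (h : term 1 (m • f) - term (c ^ m) 0 ∈ J) :
    term 1 (((X : ℤ[X]) - (transformingDegree σ m : ℤ[X])) • f) -
      term (σ c / c ^ transformingDegree σ m) 0 ∈ J := by
  have hpow : ∀ k : ℕ, (term c⁻¹ f : LaurentDiffPoly F n) ^ k = term (c ^ k)⁻¹ (k • f) :=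
    fun k => by simp [term, AddMonoidAlgebra.single_pow]
  have hu : (term c⁻¹ f : LaurentDiffPoly F n) ^ m - 1 ∈ J := by
    have h1 := J.mul_mem_left (term (c ^ m)⁻¹ 0) h
    rwa [mul_sub, term_mul_term, term_mul_term, mul_one, zero_add, add_zero,
      inv_mul_cancel₀ (pow_ne_zero _ hc), ← hpow] at h1
  have hs : ∀ a : F, transform σ n (algebraMap F _ a) = algebraMap F _ (σ a) := fun a => by
    have := transform_term σ n a 0
    rwa [smul_zero] at this
  have h2 := J.mul_mem_left (term (σ c) (-(transformingDegree σ m • f)))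
    (hJ.map_sub_pow_mem hs hm hu)
  rw [transform_term, hpow, mul_sub, term_mul_term, term_mul_term, neg_add_cancel, map_inv₀,
    mul_inv_cancel₀ ((map_ne_zero σ).2 hc), ← div_eq_mul_inv] at h2
  rwa [sub_smul, Nat.cast_smul_eq_nsmul, sub_eq_neg_add (_ • f)]

theorem IsPerfect.isPSaturated_supportLattice (hσ : Function.Bijective σ)
    (hJ : IsPerfect (transform σ n) J) : IsPSaturated σ (supportLattice J hJ.1) := by
  refine ⟨?_, ?_⟩
  · rintro f ⟨c, hc, h⟩
    obtain ⟨d, rfl⟩ := hσ.2 c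
    refine ⟨d, (map_ne_zero σ).1 hc, hJ.mem_of_map_mem ?_⟩
    rwa [map_sub, transform_term, transform_term, map_one, smul_zero]
  · rintro m hm f ⟨c, hc, h⟩
    obtain ⟨d, rfl⟩ := IsAlgClosed.exists_pow_nat_eq c (by omega : 0 < m)
    have hd : d ≠ 0 := by
      rintro rfl
      exact hc (zero_pow (by omega))
    exact ⟨_, div_ne_zero ((map_ne_zero σ).2 hd) (pow_ne_zero _ hd), hJ.term_sub_mem hm hd h⟩

/-- The ideal of a partial character `ρ` on an `x`-saturated lattice is perfect if every
extension of `ρ` commutes with the transforming operators on torsion elements modulo the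
lattice. -/
theorem PartialCharacter.isPerfect_ideal (hσ : Function.Bijective σ) (ρ : PartialCharacter σ n)
    (hX : ∀ f : Fin n → ℤ[X], (X : ℤ[X]) • f ∈ ρ.lattice → f ∈ ρ.lattice)
    (hρ : ∀ ψ, ρ.ExtendsTo ψ → ∀ m : ℕ, 2 ≤ m → ∀ f : Fin n → ℤ[X], m • f ∈ ρ.lattice →
      ((ψ ((X : ℤ[X]) • f)).toMul : F) = σ (ψ f).toMul) :
    IsPerfect (transform σ n) ρ.ideal := by
  -- `S` is the `ℤ`-saturation of the lattice. By `hρ`, each extension restricts to a partial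
  -- character on `S`.
  let S : Submodule ℤ[X] (Fin n → ℤ[X]) :=
    { carrier := {f | ∃ m : ℕ, m ≠ 0 ∧ m • f ∈ ρ.lattice}
      zero_mem' := ⟨1, one_ne_zero, by simp⟩
      add_mem' := by
        rintro f g ⟨k, hk, hf⟩ ⟨l, hl, hg⟩
        refine ⟨k * l, mul_ne_zero hk hl, ?_⟩
        rw [smul_add, mul_smul, mul_smul, smul_comm k l f]
        exact add_mem (nsmul_mem hf l) (nsmul_mem hg k)
      smul_mem' := by
        rintro q f ⟨k, hk, hf⟩
        exact ⟨k, hk, by rw [smul_comm]; exact ρ.lattice.smul_mem q hf⟩ }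
  let ρS : {ψ // ρ.ExtendsTo ψ} → PartialCharacter σ n := fun ψ =>
    { lattice := S
      toFun := fun f => (ψ.1 f).toMul
      map_add := fun f g => by
        rw [Submodule.coe_add, _root_.map_add, toMul_add]
      map_X_smul := by
        rintro ⟨f, k, hk, hf⟩
        -- Doubling `k` secures the bound `2 ≤ m`, since `k` may be 1.
        refine hρ ψ.1 ψ.2 (2 * k) (by omega) f ?_
        rw [mul_smul]
        exact nsmul_mem hf 2 }
  -- The characters extending `ρ` are exactly those extending some `ρS ψ`, so the vanishing ideals
  -- intersect to `I(ρ)`.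
  have hS : ρ.ideal = ⨅ ψ, (ρS ψ).ideal := by
    refine Ideal.ext fun p => ?_
    rw [mem_ideal_iff hσ, Submodule.mem_iInf]
    refine ⟨fun h ψ => (mem_ideal_iff hσ).2 fun χ hχ => h χ fun f => ?_, fun h ψ hψ => ?_⟩
    · rw [hχ ⟨f, 1, one_ne_zero, by simp⟩]
      exact ψ.2 f
    · exact (mem_ideal_iff hσ).1 (h ⟨ψ, hψ⟩) ψ fun f => rfl
  rw [hS]
  refine isPerfect_iInf fun ψ => isPerfect_ideal_of_saturated hσ _ ?_ ?_
  · rintro f ⟨k, hk, hf⟩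
    exact ⟨k, hk, hX _ (by rwa [smul_comm])⟩
  · rintro m hm f ⟨k, hk, hf⟩
    exact ⟨k * m, mul_ne_zero hk hm, by rwa [mul_smul]⟩

/-- If `m f ∈ P`, P-saturation puts `(x - o_m) f` in `P`, where `J` prescribes the value `σ(c) / c ^
o_m` with `c = ψ(f)`. Cancelling `c ^ o_m` gives `ψ(x f) = σ(ψ(f))`. -/
theorem IsPerfect.isPerfect_ofIdeal (hσ : Function.Bijective σ)
    (hJ : IsPerfect (transform σ n) J) (hJ1 : J ≠ ⊤) {P : Submodule ℤ[X] (Fin n → ℤ[X])}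
    (hP : P ≤ supportLattice J hJ.1) (hPs : IsPSaturated σ P) :
    IsPerfect (transform σ n) (PartialCharacter.ofIdeal hJ.1 hJ1 P hP).ideal := by
  refine PartialCharacter.isPerfect_ideal hσ _ hPs.1 fun ψ hψ m hm f hf => ?_
  set c : F := ((ψ f).toMul : F) with hc
  have hc0 : c ≠ 0 := Units.ne_zero _
  have h1 : (term 1 (m • f) - term (c ^ m) 0 : LaurentDiffPoly F n) ∈ J := by
    have h := hψ.term_sub_mem hJ.1 hJ1 hP hf
    rwa [map_nsmul, toMul_nsmul, Units.val_pow_eq_pow_val] at h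
  have h2 := support_value_unique hJ1 (hψ.term_sub_mem hJ.1 hJ1 hP (hPs.2 m hm f hf))
    (hJ.term_sub_mem hm hc0 h1)
  rw [sub_smul, Nat.cast_smul_eq_nsmul, map_sub, map_nsmul, toMul_sub,
    toMul_nsmul, Units.val_div_eq_div_val, Units.val_pow_eq_pow_val, ← hc] at h2
  exact (div_left_inj' (pow_ne_zero _ hc0)).1 h2

/-- The perfect closure of the ideal of a partial character. -/
theorem PartialCharacter.perfectClosure_ideal (hσ : Function.Bijective σ)
    (ρ : PartialCharacter σ n) :
    perfectClosure (transform σ n) ρ.ideal = ⊤ ∨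
      (IsBinomialDiffIdeal σ (perfectClosure (transform σ n) ρ.ideal) ∧
        supportLattice (perfectClosure (transform σ n) ρ.ideal)
          (isDiffIdeal_perfectClosure (transform σ n) ρ.ideal) = pSaturation σ ρ.lattice) := by
  refine or_iff_not_imp_left.2 fun hJ1 => ?_
  obtain ⟨⟨hJ, hle⟩, hleast⟩ := isLeast_perfectClosure (transform σ n) ρ.ideal
  obtain ⟨⟨hPs, hLP⟩, hPleast⟩ := isLeast_pSaturation σ ρ.lattice
  have hP : pSaturation σ ρ.lattice ≤ supportLattice _ hJ.1 :=
    hPleast ⟨hJ.isPSaturated_supportLattice hσ, fun f hf =>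
      ⟨_, Units.ne_zero _, hle (ρ.generator_mem_ideal ⟨f, hf⟩)⟩⟩
  have heq : perfectClosure (transform σ n) ρ.ideal = (ofIdeal hJ.1 hJ1 _ hP).ideal := by
    refine le_antisymm (hleast ⟨hJ.isPerfect_ofIdeal hσ hJ1 hP hPs, ?_⟩)
      (ofIdeal_ideal_le hJ.1 hJ1 hP)
    refine (isLeast_diffSpan _ _).2 ⟨isDiffIdeal_diffSpan _ _, ?_⟩
    rintro _ ⟨f, rfl⟩
    exact mem_ofIdeal_ideal hJ.1 hJ1 hP (hLP f.2) (hle (ρ.generator_mem_ideal f))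
  refine ⟨heq ▸ isBinomialDiffIdeal_ideal _, le_antisymm ?_ hP⟩
  rintro f ⟨c, -, hf⟩
  rw [heq] at hf
  exact mem_lattice_of_mem_ideal hσ hf

end Support

end LaurentDiff

theorem mainTheorem8 {F : Type*} [Field F] [IsAlgClosed F] [CharZero F]
    (σ : F →+* F) (hσ : Function.Bijective σ) (n : ℕ) :
    (∀ ρ : LaurentDiff.PartialCharacter σ n,
      LaurentDiff.perfectClosure (LaurentDiff.transform σ n) ρ.ideal = ⊤ ∨
        (LaurentDiff.IsBinomialDiffIdeal σ
            (LaurentDiff.perfectClosure (LaurentDiff.transform σ n) ρ.ideal) ∧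
          LaurentDiff.supportLattice
              (LaurentDiff.perfectClosure (LaurentDiff.transform σ n) ρ.ideal)
              (LaurentDiff.isDiffIdeal_perfectClosure (LaurentDiff.transform σ n) ρ.ideal) =
            LaurentDiff.pSaturation σ ρ.lattice)) ∧
    (∀ (I : Ideal (LaurentDiff.LaurentDiffPoly F n))
        (hI : LaurentDiff.IsBinomialDiffIdeal σ I),
      LaurentDiff.perfectClosure (LaurentDiff.transform σ n) I = ⊤ ∨
        (LaurentDiff.IsBinomialDiffIdeal σ
            (LaurentDiff.perfectClosure (LaurentDiff.transform σ n) I) ∧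
          LaurentDiff.supportLattice
              (LaurentDiff.perfectClosure (LaurentDiff.transform σ n) I)
              (LaurentDiff.isDiffIdeal_perfectClosure (LaurentDiff.transform σ n) I) =
            LaurentDiff.pSaturation σ (LaurentDiff.supportLattice I hI.isDiffIdeal))) := by
  refine ⟨fun ρ => ρ.perfectClosure_ideal hσ, fun I hI => ?_⟩
  by_cases hI1 : I = ⊤
  · left
    have h := (LaurentDiff.isLeast_perfectClosure (LaurentDiff.transform σ n) I).1.2
    exact top_le_iff.1 (hI1 ▸ h)
  -- The lattice of this character is by definition the whole support lattice of `I`.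
  · have h := (LaurentDiff.PartialCharacter.ofIdeal hI.isDiffIdeal hI1 _
      le_rfl).perfectClosure_ideal hσ
    simp only [← hI.eq_ideal hI1] at h
    exact h
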